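/- Let $\mathbb K=\mathbb C(p_1,\dots,p_m)$ and $R=\mathbb K[x_1,\dots,x_n]$. Let $\tilde I\subset \mathbb C[x_1,\dots,x_n,p_1,\dots,p_m]$ be an ideal with $\tilde I\cap\mathbb C[p_1,\dots,p_m]=\{0\}$ whose extension $I\subset R$ is zero-dimensional (that is, $\dim_{\mathbb K}R/I<\infty$), and let $<$ be a monomial order on the monomials in $x_1,\dots,x_n$. **Definitions.** These are stated over a field $k$ (here $k=\mathbb K$ or $k=\mathbb C$), for a zero-dimensional ideal $I=\langle f_1,\dots,f_r\rangle\subset k[x]$ and $f\in k[x]$. Let $\mathcal B=\{x^{\alpha_1}>\dots>x^{\alpha_d}\}$ be the set of standard monomials of $I$, i.e. of the monomials not in $\operatorname{in}_<(I)$, and $v(\mathcal B)=(x^{\alpha_1},\dots,x^{\alpha_d})^T$. The *action matrix* $A=(a_{ij})\in k^{d\times d}$ is given by $[f x^{\alpha_i}]=\sum_j a_{ij}[x^{\alpha_j}]$ in $k[x]/I$. Let $H\in k[x]^{d\times r}$ be a matrix with $$ s\,v(\mathcal B)-A\,v(\mathcal B)=(s-f)\,v(\mathcal B)+H\cdot(f_1,\dots,f_r)^T\quad\text{in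 } k[x][s]. $$ Let $\mathcal S_i$ be the set of monomials occurring in the $i$-th column of $H$, and let $\mathcal E$ be the set of monomials in $\mathcal B$, in $s\mathcal B$, or in the support of some $x^\beta f_i$ with $x^\beta\in\mathcal S_i$, that do not lie in $\mathcal B\cup s\mathcal B$. The *template matrix* $M$ has as rows the coefficient vectors of all $x^\beta f_i$ with $x^\beta\in\mathcal S_i$, $1\le i\le r$, followed by those of $(s-f)x^{\alpha_1},\dots,(s-f)x^{\alpha_d}$; its columns are indexed by $\mathcal E$ followed by $\mathcal B$. The data $(f,(f_i),\mathcal B,A,H,(\mathcal S_i),\mathcal E,M)$ are an *elimination template* for $I$ and $<$. A *reduction* of it is a finite sequence of elementary matrices $E_1,\dots,E_\ell$ over $k$ such that $$E_1\cdots E_\ell\,M=\begin{pmatrix} * & *\\ 0 & -A\end{pmatrix},$$ where the last $d$ rows and the last $d$ columns are split off. For $P\in\mathbb C^m$, an element of $\mathbb K$ is regular at $P$ if it is a quotient $g/h$ of polynomials in $p$ with $h(P)\neq0$, and its specialization is then $g(P)/h(P)$. Polynomials in $x$ and matrices specialize coefficientwise and entrywise. $\Psi_P(I)\subset\mathbb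 C[x]$ is the ideal generated by the specializations of all elements of $I$ whose coefficients are regular at $P$. **Theorem.** For every $f\in R$ and every finite generating family $(f_1,\dots,f_r)$ of $I$ in $R$ there is an elimination template for $I$ and $<$ built from $f$ and $(f_i)$, and every elimination template for $I$ and $<$ has a reduction. Moreover, for every elimination template $(f,(f_i),\mathcal B,A,H,(\mathcal S_i),\mathcal E,M)$ for $I$ and $<$ and every reduction $E_1,\dots,E_\ell$ of it there is a dense Zariski-open subset $\mathcal U\subset\mathbb C^m$ such that for all $P\in\mathcal U$: 1. $\Psi_P(I)$ equals the image of $\tilde I$ under the substitution $p=P$; 2. all coefficients and entries of $f$, $f_i$, $A$, $H$, $M$ and $E_1,\dots,E_\ell$ are regular at $P$; write $f^P,f_i^P,A^P,H^P,M^P,E_j^P$ for the specializations; 3. $(f^P,(f_i^P),\mathcal B,A^P,H^P,(\mathcal S_i),\mathcal E,M^P)$ is an elimination template for $\Psi_P(I)$ and $<$; in particular $\Psi_P(I)$ is zero-dimensional with the same standard monomials $\mathcal B$, $A^P$ is its action matrix, and the shift sets and the excessive monomials do not change; 4. $E_1^P,\dots,E_\ell^P$ are elementary matrices and form a reduction of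 this template, and $E_1^P\cdots E_\ell^P M^P$ is the specialization of $E_1\cdots E_\ell M$ and has its zero entries in exactly the same positions (so a row-echelon form specializes to a row-echelon form with the same pivots). -/

import Mathlib

universe u

/-! ### Monomials, initial ideals and action matrices -/

/-- The initial ideal `in_<(I)`, generated by the leading terms of the elements of `I`. -/
noncomputable def initialIdeal {n : ℕ} {k : Type*} [Field k] (ord : MonomialOrder.{0, u} (Fin n))
    (I : Ideal (MvPolynomial (Fin n) k)) : Ideal (MvPolynomial (Fin n) k) :=
  Ideal.span (ord.leadingTerm '' (I : Set (MvPolynomial (Fin n) k)))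

/-- The exponents `α` of the standard monomials of `I`, i.e. `x^α ∉ in_<(I)`. -/
def standardExponents {n : ℕ} {k : Type*} [Field k] (ord : MonomialOrder.{0, u} (Fin n))
    (I : Ideal (MvPolynomial (Fin n) k)) : Set (Fin n →₀ ℕ) :=
  {α | MvPolynomial.monomial α (1 : k) ∉ initialIdeal ord I}

/-- `I` is zero-dimensional in the sense that `k[x]/I` is a finite-dimensional vector space. -/
def IsZeroDimensional {n : ℕ} {k : Type*} [Field k] (I : Ideal (MvPolynomial (Fin n) k)) : Prop :=
  Module.Finite k (MvPolynomial (Fin n) k ⧸ I)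

/-- `B = (x^{α_1}, …, x^{α_d})` lists all standard monomials of `I`, in strictly decreasing
order `α_1 > ⋯ > α_d`. -/
def IsStandardBasis {n d : ℕ} {k : Type*} [Field k] (ord : MonomialOrder.{0, u} (Fin n))
    (I : Ideal (MvPolynomial (Fin n) k)) (B : Fin d → (Fin n →₀ ℕ)) : Prop :=
  StrictAnti (fun i => ord.toSyn (B i)) ∧ Set.range B = standardExponents ord I

/-- `A` is the matrix of multiplication by `f` on `k[x]/I` with respect to the monomials `B`:
`[f x^{α_i}] = ∑ j, a_{ij} [x^{α_j}]`. -/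
def IsActionMatrix {n d : ℕ} {k : Type*} [Field k] (I : Ideal (MvPolynomial (Fin n) k))
    (f : MvPolynomial (Fin n) k) (B : Fin d → (Fin n →₀ ℕ)) (A : Matrix (Fin d) (Fin d) k) :
    Prop :=
  ∀ i, Ideal.Quotient.mk I (f * MvPolynomial.monomial (B i) 1) =
    ∑ j, A i j • Ideal.Quotient.mk I (MvPolynomial.monomial (B j) 1)

/-! ### Elimination templates

The ring `R[s]` is `Polynomial (MvPolynomial (Fin n) k)`, with `s = Polynomial.X`; its monomial
`s^a x^α` is encoded by the pair `(a, α) : ℕ × (Fin n →₀ ℕ)`. -/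

/-- The coefficient of `s^a x^α` in an element of `R[s]`. -/
noncomputable def coeffS {n : ℕ} {k : Type*} [Field k]
    (q : Polynomial (MvPolynomial (Fin n) k)) (μ : ℕ × (Fin n →₀ ℕ)) : k :=
  (q.coeff μ.1).coeff μ.2

/-- The `i`-th shift set: the monomials appearing in some entry of the `i`-th column of `H`. -/
def shiftSet {n d r : ℕ} {k : Type*} [Field k]
    (H : Matrix (Fin d) (Fin r) (MvPolynomial (Fin n) k)) (i : Fin r) : Finset (Fin n →₀ ℕ) :=
  Finset.univ.biUnion fun a => (H a i).support

/-- The basic monomials `x^{α_i}`. -/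
def basicMonomials {n d : ℕ} (B : Fin d → (Fin n →₀ ℕ)) : Finset (ℕ × (Fin n →₀ ℕ)) :=
  Finset.univ.image fun i => (0, B i)

/-- The reducible monomials `s x^{α_i}`. -/
def reducibleMonomials {n d : ℕ} (B : Fin d → (Fin n →₀ ℕ)) : Finset (ℕ × (Fin n →₀ ℕ)) :=
  Finset.univ.image fun i => (1, B i)

/-- All monomials that are basic, reducible, or in the support of a shifted generator
`x^β f_i` with `x^β` in the `i`-th shift set. -/
noncomputable def templateMonomials {n d r : ℕ} {k : Type*} [Field k]
    (F : Fin r → MvPolynomial (Fin n) k) (B : Fin d → (Fin n →₀ ℕ))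
    (H : Matrix (Fin d) (Fin r) (MvPolynomial (Fin n) k)) : Finset (ℕ × (Fin n →₀ ℕ)) :=
  basicMonomials B ∪ reducibleMonomials B ∪
    Finset.univ.biUnion fun i => (shiftSet H i).biUnion fun β =>
      (MvPolynomial.monomial β 1 * F i).support.image fun γ => (0, γ)

/-- The excessive monomials: those that are neither basic nor reducible. -/
noncomputable def excessiveMonomials {n d r : ℕ} {k : Type*} [Field k]
    (F : Fin r → MvPolynomial (Fin n) k) (B : Fin d → (Fin n →₀ ℕ))
    (H : Matrix (Fin d) (Fin r) (MvPolynomial (Fin n) k)) : Finset (ℕ × (Fin n →₀ ℕ)) :=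
  templateMonomials F B H \ (basicMonomials B ∪ reducibleMonomials B)

/-- The Macaulay-type matrix whose rows are the coefficient vectors of the shifted generators
`x^β f_i`, `x^β ∈ S i`, followed by those of `(s - f) x^{α_a}`, and whose columns are labelled by
the monomials in `E`, followed by the basic monomials. -/
noncomputable def templateMatrix {n d r : ℕ} {k : Type*} [Field k]
    (f : MvPolynomial (Fin n) k) (F : Fin r → MvPolynomial (Fin n) k)
    (B : Fin d → (Fin n →₀ ℕ)) (S : Fin r → Finset (Fin n →₀ ℕ))
    (E : Finset (ℕ × (Fin n →₀ ℕ))) : Matrix ((Σ i, S i) ⊕ Fin d) (E ⊕ Fin d) k :=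
  Matrix.of fun row col =>
    coeffS
      (Sum.elim
        (fun t : Σ i, S i => Polynomial.C (MvPolynomial.monomial (t.2 : Fin n →₀ ℕ) 1 * F t.1))
        (fun a => (Polynomial.X - Polynomial.C f) *
          Polynomial.C (MvPolynomial.monomial (B a) 1)) row)
      (Sum.elim (fun e : E => (e : ℕ × (Fin n →₀ ℕ))) (fun b => (0, B b)) col)

/-- The data `(f, F, B, A, H, S, E, M)` form an elimination template of the zero-dimensional ideal
`I` for the monomial order `ord`. -/
structure IsEliminationTemplate {n d r : ℕ} {k : Type*} [Field k]
    (ord : MonomialOrder.{0, u} (Fin n)) (I : Ideal (MvPolynomial (Fin n) k))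
    (f : MvPolynomial (Fin n) k) (F : Fin r → MvPolynomial (Fin n) k)
    (B : Fin d → (Fin n →₀ ℕ)) (A : Matrix (Fin d) (Fin d) k)
    (H : Matrix (Fin d) (Fin r) (MvPolynomial (Fin n) k))
    (S : Fin r → Finset (Fin n →₀ ℕ)) (E : Finset (ℕ × (Fin n →₀ ℕ)))
    (M : Matrix ((Σ i, S i) ⊕ Fin d) (E ⊕ Fin d) k) : Prop where
  zeroDimensional : IsZeroDimensional I
  generators : Ideal.span (Set.range F) = I
  basis : IsStandardBasis ord I B
  action : IsActionMatrix I f B A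
  /-- `s v(B) - A v(B) = (s - f) v(B) + H v(F)` in `R[s]`. -/
  relation : ∀ a,
    Polynomial.X * Polynomial.C (MvPolynomial.monomial (B a) (1 : k)) -
        ∑ b, Polynomial.C (MvPolynomial.C (A a b) * MvPolynomial.monomial (B b) 1) =
      (Polynomial.X - Polynomial.C f) * Polynomial.C (MvPolynomial.monomial (B a) 1) +
        ∑ i, Polynomial.C (H a i * F i)
  shifts : S = shiftSet H
  excessive : E = excessiveMonomials F B H
  matrix : M = templateMatrix f F B S E

/-- Elementary matrices: row additions, scalings of one row by a nonzero scalar, row swaps. -/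
def IsElementaryMatrix {ι : Type*} [DecidableEq ι] {k : Type*} [Field k]
    (T : Matrix ι ι k) : Prop :=
  (∃ i j, i ≠ j ∧ ∃ c : k, T = Matrix.transvection i j c) ∨
  (∃ i, ∃ c : k, c ≠ 0 ∧ T = Matrix.diagonal (Function.update 1 i c)) ∨
  (∃ i j, i ≠ j ∧ T = Matrix.swap k i j)

/-- The elementary matrices `L = [E_1, …, E_ℓ]` reduce the template matrix `M` to the block form
`E_1 ⋯ E_ℓ M = (* *; 0 -A)`, from which the action matrix is read off. -/
structure IsTemplateReduction {d : ℕ} {ι κ : Type*} [Fintype ι] [DecidableEq ι] {k : Type*}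
    [Field k] (M : Matrix (ι ⊕ Fin d) (κ ⊕ Fin d) k) (A : Matrix (Fin d) (Fin d) k)
    (L : List (Matrix (ι ⊕ Fin d) (ι ⊕ Fin d) k)) : Prop where
  elementary : ∀ T ∈ L, IsElementaryMatrix T
  block : ∃ X Y, L.prod * M = Matrix.fromBlocks X Y 0 (-A)

/-! ### Specialization of the parameters -/

/-- The coefficient field `ℂ(p_1, …, p_m)`. -/
abbrev ParamField (m : ℕ) : Type := FractionRing (MvPolynomial (Fin m) ℂ)

/-- The rational function `a` is regular at `P` and takes the value `b` there: `a = g / h` with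
`h(P) ≠ 0` and `b = g(P) / h(P)`. -/
def SpecializesTo {m : ℕ} (P : Fin m → ℂ) (a : ParamField m) (b : ℂ) : Prop :=
  ∃ g h : MvPolynomial (Fin m) ℂ, MvPolynomial.eval P h ≠ 0 ∧
    a = algebraMap _ (ParamField m) g / algebraMap _ (ParamField m) h ∧
    b = MvPolynomial.eval P g / MvPolynomial.eval P h

theorem SpecializesTo.unique {m : ℕ} {P : Fin m → ℂ} {a : ParamField m} {b b' : ℂ}
    (hb : SpecializesTo P a b) (hb' : SpecializesTo P a b') : b = b' := by
  obtain ⟨g, h, hP, rfl, rfl⟩ := hb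
  obtain ⟨g', h', hP', e, rfl⟩ := hb'
  have h0 : h ≠ 0 := by rintro rfl; simp at hP
  have h0' : h' ≠ 0 := by rintro rfl; simp at hP'
  have inj := IsFractionRing.injective (MvPolynomial (Fin m) ℂ) (ParamField m)
  have k0 : algebraMap _ (ParamField m) h ≠ 0 := (map_ne_zero_iff _ inj).2 h0
  have k0' : algebraMap _ (ParamField m) h' ≠ 0 := (map_ne_zero_iff _ inj).2 h0'
  rw [div_eq_div_iff k0 k0', ← map_mul, ← map_mul] at e
  have e' := congrArg (MvPolynomial.eval P) (inj e)
  rw [map_mul, map_mul] at e'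
  rw [div_eq_div_iff hP hP']
  exact e'

/-- The partial map `Ψ_P` on polynomials: all coefficients of `q` are regular at `P`, and
evaluating them there gives `q'`. -/
def PolySpecializesTo {m n : ℕ} (P : Fin m → ℂ) (q : MvPolynomial (Fin n) (ParamField m))
    (q' : MvPolynomial (Fin n) ℂ) : Prop :=
  ∀ α, SpecializesTo P (q.coeff α) (q'.coeff α)

/-- Entrywise specialization of a matrix of rational functions. -/
def MatrixSpecializesTo {m : ℕ} {ι κ : Type*} (P : Fin m → ℂ) (M : Matrix ι κ (ParamField m))
    (M' : Matrix ι κ ℂ) : Prop :=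
  ∀ i j, SpecializesTo P (M i j) (M' i j)

/-- The extension to `ℂ(p)[x]` of an ideal of `ℂ[x, p] = ℂ[p][x]`. -/
noncomputable def extendedIdeal {m n : ℕ}
    (J : Ideal (MvPolynomial (Fin n) (MvPolynomial (Fin m) ℂ))) :
    Ideal (MvPolynomial (Fin n) (ParamField m)) :=
  J.map (MvPolynomial.map (algebraMap (MvPolynomial (Fin m) ℂ) (ParamField m)))

/-- The specialized ideal `Ψ_P(I)`: the specializations of all elements of `I` whose coefficients
are regular at `P`. -/
noncomputable def specializedIdeal {m n : ℕ} (P : Fin m → ℂ) (I : Ideal (MvPolynomial (Fin n) (ParamField m))) :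
    Ideal (MvPolynomial (Fin n) ℂ) :=
  Ideal.span {q' | ∃ q ∈ I, PolySpecializesTo P q q'}

/-! ### The Zariski topology of `ℂ^m` -/

/-- Zariski-open subsets of `ℂ^m`: complements of common zero sets of polynomials. -/
def IsZariskiOpen {m : ℕ} (U : Set (Fin m → ℂ)) : Prop :=
  ∃ T : Set (MvPolynomial (Fin m) ℂ), U = {P | ∃ h ∈ T, MvPolynomial.eval P h ≠ 0}

/-- Zariski-dense subsets of `ℂ^m`: those that meet every nonempty Zariski-open set. -/
def IsZariskiDense {m : ℕ} (U : Set (Fin m → ℂ)) : Prop :=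
  ∀ V : Set (Fin m → ℂ), IsZariskiOpen V → V.Nonempty → (U ∩ V).Nonempty

/-! ### Initial ideals and standard monomials -/

/-! A template is a certificate made of finitely many elements of `ℂ(p)`. The normal form of `f x^α`
modulo `I` gives a row of `A`, and the difference, lying in `I = ⟨f_i⟩`, has cofactors that form a
row of `H`. Using the coefficients of `H` as row multipliers on `M` turns the rows of `(s - f) x^α`
into those of `s x^α - ∑ a_ij x^{α_j}`, which is the required block form.

Generically each of these scalars is regular and its value vanishes only if the scalar does.
Polynomial identities therefore specialize, supports and zero patterns persist, and elementary
matrices stay elementary.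

What remains is a statement about all of `I` at once: the standard monomials of `Ψ_P(I)` must again
be `B`. Take a finite `G` in the integral ideal `J` whose leading monomials generate the initial
ideal of `I`. If no leading coefficient of `G` vanishes at `P`, dividing any `q ∈ I` regular at `P`
by `G` introduces no new poles at `P`. Hence the specialized `G` generates `Ψ_P(I)`, and no new
leading monomials appear (`PolySpecializesTo.mem_and_degree_of_mem`). The excluded locus depends on
`G` and not on `q`, so a single open set serves all of `I`. -/

/-- A monomial lies in a monomial ideal exactly when some generating monomial divides it; `≤` on
exponents is divisibility, not the monomial order. -/
theorem monomial_mem_initialIdeal_iff {n : ℕ} {k : Type*} [Field k]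
    (ord : MonomialOrder.{0, u} (Fin n)) (I : Ideal (MvPolynomial (Fin n) k))
    (α : Fin n →₀ ℕ) :
    MvPolynomial.monomial α (1 : k) ∈ initialIdeal ord I ↔
      ∃ q ∈ I, q ≠ 0 ∧ ord.degree q ≤ α := by
  classical
  rw [initialIdeal, MonomialOrder.span_leadingTerm_eq_span_monomial',
    ← Set.image_image (fun s => MvPolynomial.monomial s (1 : k)) ord.degree,
    MvPolynomial.mem_ideal_span_monomial_image]
  simp only [MvPolynomial.support_monomial, one_ne_zero, if_false, Finset.mem_singleton,
    forall_eq]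
  constructor
  · rintro ⟨_, ⟨q, ⟨hq, hq0⟩, rfl⟩, h⟩
    exact ⟨q, hq, hq0, h⟩
  · rintro ⟨q, hq, hq0, h⟩
    exact ⟨_, ⟨q, ⟨hq, hq0⟩, rfl⟩, h⟩

theorem MonomialOrder.degree_monomial_sub_mul {n : ℕ} {k : Type*} [Field k]
    (ord : MonomialOrder.{0, u} (Fin n)) {q : MvPolynomial (Fin n) k} (hq : q ≠ 0)
    {α : Fin n →₀ ℕ} (h : ord.degree q ≤ α) {c : k} (hc : c ≠ 0) :
    ord.degree (MvPolynomial.monomial (α - ord.degree q) c * q) = α := by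
  classical
  rw [ord.degree_mul (by simpa using hc) hq, ord.degree_monomial, if_neg hc,
    tsub_add_cancel_of_le h]

/-- Cancelling the leading term lowers the degree. -/
theorem MonomialOrder.sub_eq_zero_or_degree_lt {n : ℕ} {k : Type*} [Field k]
    (ord : MonomialOrder.{0, u} (Fin n)) {p t : MvPolynomial (Fin n) k}
    (hd : ord.degree t = ord.degree p) (hc : ord.leadingCoeff t = ord.leadingCoeff p) :
    p - t = 0 ∨ ord.toSyn (ord.degree (p - t)) < ord.toSyn (ord.degree p) := by
  by_cases h : p - t = 0
  · exact Or.inl h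
  · right
    refine lt_of_le_of_ne ?_ fun e => ?_
    · simpa [hd] using ord.degree_sub_le (f := p) (g := t)
    · have e' := ord.toSyn.injective e
      have h1 := ord.coeff_degree_ne_zero_iff.2 h
      rw [e', MvPolynomial.coeff_sub] at h1
      apply h1
      rw [MonomialOrder.leadingCoeff, MonomialOrder.leadingCoeff, hd] at hc
      rw [hc, sub_self]

/-- One division step. Zero is a separate outcome because `ord.degree 0 = 0`, so the degree need not
drop when `p` is a constant. -/
theorem MonomialOrder.reduce_eq_zero_or_degree_lt {n : ℕ} {k : Type*} [Field k]
    (ord : MonomialOrder.{0, u} (Fin n)) {p q : MvPolynomial (Fin n) k} (hp : p ≠ 0) (hq : q ≠ 0)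
    (h : ord.degree q ≤ ord.degree p) :
    p - MvPolynomial.monomial (ord.degree p - ord.degree q)
        (ord.leadingCoeff p / ord.leadingCoeff q) * q = 0 ∨
      ord.toSyn (ord.degree (p - MvPolynomial.monomial (ord.degree p - ord.degree q)
        (ord.leadingCoeff p / ord.leadingCoeff q) * q)) < ord.toSyn (ord.degree p) := by
  have hp' := ord.leadingCoeff_ne_zero_iff.2 hp
  have hq' := ord.leadingCoeff_ne_zero_iff.2 hq
  apply ord.sub_eq_zero_or_degree_lt
  · exact ord.degree_monomial_sub_mul hq h (div_ne_zero hp' hq')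
  · rw [ord.leadingCoeff_mul, ord.leadingCoeff_monomial, div_mul_cancel₀ _ hq']

/-- Every polynomial is congruent modulo `I` to one supported on standard monomials. -/
theorem exists_sub_mem_support_subset_standardExponents {n : ℕ} {k : Type*} [Field k]
    (ord : MonomialOrder.{0, u} (Fin n)) (I : Ideal (MvPolynomial (Fin n) k))
    (p : MvPolynomial (Fin n) k) :
    ∃ r, p - r ∈ I ∧ ∀ α ∈ r.support, α ∈ standardExponents ord I := by
  classical
  induction hs : ord.toSyn (ord.degree p) using WellFoundedLT.induction generalizing p with
  | _ s ih =>
  by_cases hp : p = 0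
  · exact ⟨0, by simp [hp], by simp⟩
  by_cases hδ : MvPolynomial.monomial (ord.degree p) (1 : k) ∈ initialIdeal ord I
  · obtain ⟨q, hq, hq0, hle⟩ := (monomial_mem_initialIdeal_iff ord I _).1 hδ
    have hmem := I.mul_mem_left (MvPolynomial.monomial (ord.degree p - ord.degree q)
        (ord.leadingCoeff p / ord.leadingCoeff q)) hq
    rcases ord.reduce_eq_zero_or_degree_lt hp hq0 hle with h | h
    · refine ⟨0, ?_, by simp⟩
      rw [sub_zero, sub_eq_zero.1 h]
      exact hmem
    · obtain ⟨r, hr, hr'⟩ := ih _ (hs ▸ h) _ rfl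
      refine ⟨r, ?_, hr'⟩
      convert I.add_mem hr hmem using 1
      ring
  -- The leading monomial is standard: set the leading term aside and reduce the tail.
  · have key : ∃ r, p - ord.leadingTerm p - r ∈ I ∧
        ∀ α ∈ r.support, α ∈ standardExponents ord I := by
      rcases ord.sub_eq_zero_or_degree_lt (ord.degree_leadingTerm p)
        (ord.leadingCoeff_leadingTerm p) with h | h
      · exact ⟨0, by simp [h], by simp⟩
      · exact ih _ (hs ▸ h) _ rfl
    obtain ⟨r, hr, hr'⟩ := key
    refine ⟨ord.leadingTerm p + r, by rwa [← sub_sub], fun α hα => ?_⟩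
    rcases Finset.mem_union.1 (MvPolynomial.support_add hα) with h | h
    · rw [ord.support_leadingTerm' hp, Finset.mem_singleton] at h
      subst h
      exact hδ
    · exact hr' α h

/-- The leading monomial of a nonzero such element would be both standard and in the initial ideal.
-/
theorem eq_zero_of_mem_of_support_subset_standardExponents {n : ℕ} {k : Type*} [Field k]
    {ord : MonomialOrder.{0, u} (Fin n)} {I : Ideal (MvPolynomial (Fin n) k)}
    {r : MvPolynomial (Fin n) k} (hr : r ∈ I)
    (h : ∀ α ∈ r.support, α ∈ standardExponents ord I) : r = 0 := by
  by_contra h0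
  exact h _ (ord.degree_mem_support h0)
    ((monomial_mem_initialIdeal_iff ord I _).2 ⟨r, hr, h0, le_rfl⟩)

/-- Serves to bound the number of standard monomials by the dimension of the quotient. -/
theorem linearIndependent_standardExponents {n : ℕ} {k : Type*} [Field k]
    (ord : MonomialOrder.{0, u} (Fin n)) (I : Ideal (MvPolynomial (Fin n) k)) :
    LinearIndependent k fun α : standardExponents ord I =>
      Ideal.Quotient.mkₐ k I (MvPolynomial.monomial (α : Fin n →₀ ℕ) 1) := by
  classical
  rw [linearIndependent_iff']
  intro s g hg i hi
  have hcoeff : ∀ α : Fin n →₀ ℕ,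
      MvPolynomial.coeff α (∑ j ∈ s, g j • MvPolynomial.monomial (j : Fin n →₀ ℕ) (1 : k)) =
        ∑ j ∈ s, if (j : Fin n →₀ ℕ) = α then g j else 0 := fun α => by
    simp [MvPolynomial.coeff_sum, MvPolynomial.coeff_monomial]
  have h0 := eq_zero_of_mem_of_support_subset_standardExponents (ord := ord) (I := I)
    (r := ∑ j ∈ s, g j • MvPolynomial.monomial (j : Fin n →₀ ℕ) (1 : k))
    (by
      rw [← Ideal.Quotient.eq_zero_iff_mem, ← Ideal.Quotient.mkₐ_eq_mk k, map_sum]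
      simpa only [map_smul] using hg)
    (fun α hα => by
      rw [MvPolynomial.mem_support_iff, hcoeff] at hα
      obtain ⟨j, -, hj⟩ := Finset.exists_ne_zero_of_sum_ne_zero hα
      have : (j : Fin n →₀ ℕ) = α := by
        by_contra hne
        exact hj (if_neg hne)
      exact this ▸ j.2)
  have h1 := hcoeff i
  rw [h0, MvPolynomial.coeff_zero, Finset.sum_eq_single i] at h1
  · simpa using h1.symm
  · intro j _ hji
    exact if_neg fun e => hji (Subtype.ext e)
  · exact fun h => (h hi).elim

theorem IsZeroDimensional.finite_standardExponents {n : ℕ} {k : Type*} [Field k]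
    {I : Ideal (MvPolynomial (Fin n) k)} (hI : IsZeroDimensional I)
    (ord : MonomialOrder.{0, u} (Fin n)) : (standardExponents ord I).Finite := by
  have : Module.Finite k (MvPolynomial (Fin n) k ⧸ I) := hI
  exact (linearIndependent_standardExponents ord I).finite

theorem IsZeroDimensional.exists_isStandardBasis {n : ℕ} {k : Type*} [Field k]
    {I : Ideal (MvPolynomial (Fin n) k)} (hI : IsZeroDimensional I)
    (ord : MonomialOrder.{0, u} (Fin n)) :
    ∃ (d : ℕ) (B : Fin d → (Fin n →₀ ℕ)), IsStandardBasis ord I B := by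
  classical
  have hfin := (hI.finite_standardExponents ord).image ord.toSyn
  -- `orderEmbOfFin` enumerates increasingly; `rev` makes the list decreasing.
  refine ⟨_, fun i => ord.toSyn.symm (hfin.toFinset.orderEmbOfFin rfl i.rev), ?_, ?_⟩
  · intro i j hij
    simpa using hij
  · ext α
    constructor
    · rintro ⟨i, rfl⟩
      have := hfin.toFinset.orderEmbOfFin_mem rfl i.rev
      rw [Set.Finite.mem_toFinset] at this
      obtain ⟨β, hβ, e⟩ := this
      simpa [← e] using hβ
    · intro hα
      have : ord.toSyn α ∈ Set.range (hfin.toFinset.orderEmbOfFin rfl) := by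
        rw [Finset.range_orderEmbOfFin, Set.Finite.coe_toFinset]
        exact ⟨α, hα, rfl⟩
      obtain ⟨i, hi⟩ := this
      exact ⟨i.rev, by simp [hi]⟩

theorem IsStandardBasis.injective {n d : ℕ} {k : Type*} [Field k]
    {ord : MonomialOrder.{0, u} (Fin n)} {I : Ideal (MvPolynomial (Fin n) k)}
    {B : Fin d → (Fin n →₀ ℕ)} (hB : IsStandardBasis ord I B) : Function.Injective B :=
  fun _ _ h => hB.1.injective (congrArg ord.toSyn h)

/-- Every polynomial is congruent modulo `I` to a linear combination of standard monomials. -/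
theorem IsStandardBasis.exists_sub_sum_mem {n d : ℕ} {k : Type*} [Field k]
    {ord : MonomialOrder.{0, u} (Fin n)} {I : Ideal (MvPolynomial (Fin n) k)}
    {B : Fin d → (Fin n →₀ ℕ)} (hB : IsStandardBasis ord I B) (p : MvPolynomial (Fin n) k) :
    ∃ c : Fin d → k, p - ∑ j, MvPolynomial.C (c j) * MvPolynomial.monomial (B j) 1 ∈ I := by
  classical
  obtain ⟨r, hr, hs⟩ := exists_sub_mem_support_subset_standardExponents ord I p
  refine ⟨fun j => r.coeff (B j), ?_⟩
  convert hr using 2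
  have hsub : r.support ⊆ Finset.univ.image B := fun α hα => by
    have := hs α hα
    rw [← hB.2] at this
    simpa using this
  conv_rhs => rw [r.as_sum]
  rw [Finset.sum_subset hsub fun α _ hα => by
      rw [MvPolynomial.notMem_support_iff.1 hα, map_zero],
    Finset.sum_image fun i _ j _ h => hB.injective h]
  simp [MvPolynomial.C_mul_monomial]

/-- The finitely many standard monomials span the quotient. This carries zero-dimensionality over to
the specialized ideal once its standard monomials are known. -/
theorem IsStandardBasis.isZeroDimensional {n d : ℕ} {k : Type*} [Field k]
    {ord : MonomialOrder.{0, u} (Fin n)} {I : Ideal (MvPolynomial (Fin n) k)}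
    {B : Fin d → (Fin n →₀ ℕ)} (hB : IsStandardBasis ord I B) : IsZeroDimensional I := by
  refine Module.Finite.of_surjective (Fintype.linearCombination k fun j =>
    Ideal.Quotient.mkₐ k I (MvPolynomial.monomial (B j) 1)) fun x => ?_
  obtain ⟨p, rfl⟩ := Ideal.Quotient.mkₐ_surjective k I x
  obtain ⟨c, hc⟩ := hB.exists_sub_sum_mem p
  refine ⟨c, ?_⟩
  rw [← Ideal.Quotient.mk_eq_mk_iff_sub_mem, map_sum] at hc
  rw [Fintype.linearCombination_apply, Ideal.Quotient.mkₐ_eq_mk, hc]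
  refine Finset.sum_congr rfl fun j _ => ?_
  rw [← MvPolynomial.smul_eq_C_mul, ← Ideal.Quotient.mkₐ_eq_mk k, map_smul]

/-! ### Existence and reduction of elimination templates -/

/-- The defining relation of a template, without the auxiliary variable `s`. -/
theorem template_relation_iff {n d r : ℕ} {k : Type*} [Field k]
    (f : MvPolynomial (Fin n) k) (F : Fin r → MvPolynomial (Fin n) k)
    (B : Fin d → (Fin n →₀ ℕ)) (A : Matrix (Fin d) (Fin d) k)
    (H : Matrix (Fin d) (Fin r) (MvPolynomial (Fin n) k)) (a : Fin d) :
    Polynomial.X * Polynomial.C (MvPolynomial.monomial (B a) (1 : k)) -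
        ∑ b, Polynomial.C (MvPolynomial.C (A a b) * MvPolynomial.monomial (B b) 1) =
      (Polynomial.X - Polynomial.C f) * Polynomial.C (MvPolynomial.monomial (B a) 1) +
        ∑ i, Polynomial.C (H a i * F i) ↔
    ∑ i, H a i * F i = f * MvPolynomial.monomial (B a) 1 -
      ∑ b, MvPolynomial.C (A a b) * MvPolynomial.monomial (B b) 1 := by
  rw [← Polynomial.C_inj (a := ∑ i, H a i * F i), Polynomial.C_sub, Polynomial.C_mul (a := f),
    map_sum Polynomial.C, map_sum Polynomial.C]
  constructor <;> intro h <;> linear_combination -h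

theorem isActionMatrix_iff {n d : ℕ} {k : Type*} [Field k] (I : Ideal (MvPolynomial (Fin n) k))
    (f : MvPolynomial (Fin n) k) (B : Fin d → (Fin n →₀ ℕ)) (A : Matrix (Fin d) (Fin d) k) :
    IsActionMatrix I f B A ↔ ∀ a, f * MvPolynomial.monomial (B a) 1 -
      ∑ b, MvPolynomial.C (A a b) * MvPolynomial.monomial (B b) 1 ∈ I := by
  refine forall_congr' fun a => ?_
  rw [← Ideal.Quotient.mk_eq_mk_iff_sub_mem, map_sum]
  simp_rw [← MvPolynomial.smul_eq_C_mul, ← Ideal.Quotient.mkₐ_eq_mk k, map_smul]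

theorem exists_isEliminationTemplate {n r : ℕ} {k : Type*} [Field k]
    (ord : MonomialOrder.{0, u} (Fin n)) {I : Ideal (MvPolynomial (Fin n) k)}
    (hI : IsZeroDimensional I) (f : MvPolynomial (Fin n) k) (F : Fin r → MvPolynomial (Fin n) k)
    (hF : Ideal.span (Set.range F) = I) :
    ∃ (d : ℕ) (B : Fin d → (Fin n →₀ ℕ)) (A : Matrix (Fin d) (Fin d) k)
      (H : Matrix (Fin d) (Fin r) (MvPolynomial (Fin n) k))
      (S : Fin r → Finset (Fin n →₀ ℕ)) (E : Finset (ℕ × (Fin n →₀ ℕ)))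
      (M : Matrix ((Σ i, S i) ⊕ Fin d) (E ⊕ Fin d) k),
      IsEliminationTemplate ord I f F B A H S E M := by
  obtain ⟨d, B, hB⟩ := hI.exists_isStandardBasis ord
  choose A hA using fun a => hB.exists_sub_sum_mem (f * MvPolynomial.monomial (B a) 1)
  have hA' := hA
  simp_rw [← hF, Ideal.mem_span_range_iff_exists_fun] at hA'
  choose H hH using hA'
  exact ⟨d, B, A, H, _, _, _, hI, hF, hB, (isActionMatrix_iff I f B A).2 hA,
    fun a => (template_relation_iff f F B A H a).2 (hH a), rfl, rfl, rfl⟩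

/-! ### Coefficients in `R[s]` and the row reduction of the template matrix -/

theorem coeffS_C {n : ℕ} {k : Type*} [Field k] (q : MvPolynomial (Fin n) k)
    (μ : ℕ × (Fin n →₀ ℕ)) :
    coeffS (Polynomial.C q) μ = if μ.1 = 0 then q.coeff μ.2 else 0 := by
  rw [coeffS, Polynomial.coeff_C]
  split_ifs <;> simp

theorem coeffS_X_mul_C {n : ℕ} {k : Type*} [Field k] (q : MvPolynomial (Fin n) k)
    (μ : ℕ × (Fin n →₀ ℕ)) :
    coeffS (Polynomial.X * Polynomial.C q) μ = if μ.1 = 1 then q.coeff μ.2 else 0 := by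
  rw [coeffS, mul_comm, Polynomial.coeff_C_mul_X]
  split_ifs <;> simp

theorem coeffS_add {n : ℕ} {k : Type*} [Field k] (p q : Polynomial (MvPolynomial (Fin n) k))
    (μ : ℕ × (Fin n →₀ ℕ)) : coeffS (p + q) μ = coeffS p μ + coeffS q μ := by
  simp [coeffS]

theorem coeffS_sub {n : ℕ} {k : Type*} [Field k] (p q : Polynomial (MvPolynomial (Fin n) k))
    (μ : ℕ × (Fin n →₀ ℕ)) : coeffS (p - q) μ = coeffS p μ - coeffS q μ := by
  simp [coeffS]

theorem coeffS_sum {n : ℕ} {k : Type*} [Field k] {ι : Type*} (s : Finset ι)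
    (p : ι → Polynomial (MvPolynomial (Fin n) k)) (μ : ℕ × (Fin n →₀ ℕ)) :
    coeffS (∑ i ∈ s, p i) μ = ∑ i ∈ s, coeffS (p i) μ := by
  simp [coeffS, MvPolynomial.coeff_sum]

/-- Multiplying such unipotent block matrices adds their lower left blocks, so splitting `N` into
single entries writes the matrix as a product of transvections. -/
theorem exists_elementary_prod_eq_fromBlocks {ι κ : Type*} [Fintype ι] [DecidableEq ι]
    [Fintype κ] [DecidableEq κ] {k : Type*} [Field k] (N : Matrix κ ι k) :
    ∃ L : List (Matrix (ι ⊕ κ) (ι ⊕ κ) k),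
      (∀ T ∈ L, IsElementaryMatrix T) ∧ L.prod = Matrix.fromBlocks 1 0 N 1 := by
  induction N using Matrix.induction_on' with
  | h_zero => exact ⟨[], by simp, by simp⟩
  | h_add p q hp hq =>
    obtain ⟨L, hL, eL⟩ := hp
    obtain ⟨L', hL', eL'⟩ := hq
    refine ⟨L ++ L', fun T hT => (List.mem_append.1 hT).elim (hL T) (hL' T), ?_⟩
    rw [List.prod_append, eL, eL', Matrix.fromBlocks_multiply]
    simp
  | h_std_basis i j c =>
    refine ⟨[Matrix.transvection (Sum.inr i) (Sum.inl j) c], ?_, ?_⟩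
    · simp only [List.mem_singleton, forall_eq]
      exact Or.inl ⟨_, _, Sum.inr_ne_inl, c, rfl⟩
    · rw [List.prod_singleton]
      ext (a | a) (b | b) <;>
        simp [Matrix.transvection, Matrix.one_apply, Matrix.single_apply]

/-- Row multipliers are the coefficients of `H`. By the defining relation the new last rows are
those of `s x^{α_a} - ∑ a_ab x^{α_b}`; as `E` contains no basic or reducible monomial, only `-A`
survives. -/
theorem IsEliminationTemplate.exists_reduction {n d r : ℕ} {k : Type*} [Field k]
    {ord : MonomialOrder.{0, u} (Fin n)} {I : Ideal (MvPolynomial (Fin n) k)}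
    {f : MvPolynomial (Fin n) k} {F : Fin r → MvPolynomial (Fin n) k}
    {B : Fin d → (Fin n →₀ ℕ)} {A : Matrix (Fin d) (Fin d) k}
    {H : Matrix (Fin d) (Fin r) (MvPolynomial (Fin n) k)}
    {S : Fin r → Finset (Fin n →₀ ℕ)} {E : Finset (ℕ × (Fin n →₀ ℕ))}
    {M : Matrix ((Σ i, S i) ⊕ Fin d) (E ⊕ Fin d) k}
    (h : IsEliminationTemplate ord I f F B A H S E M) : ∃ L, IsTemplateReduction M A L := by
  classical
  obtain ⟨L, hL, eL⟩ := exists_elementary_prod_eq_fromBlocks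
    (Matrix.of fun a (t : Σ i, S i) => (H a t.1).coeff (t.2 : Fin n →₀ ℕ))
  refine ⟨L, hL, M.toBlocks₁₁, M.toBlocks₁₂, ?_⟩
  -- `S i` collects monomials from all rows of `H`; those absent from row `a` contribute zero.
  have hH : ∀ a i, ∑ β : S i, MvPolynomial.C ((H a i).coeff (β : Fin n →₀ ℕ)) *
      MvPolynomial.monomial (β : Fin n →₀ ℕ) 1 = H a i := fun a i => by
    rw [Finset.sum_coe_sort (S i) fun β => MvPolynomial.C ((H a i).coeff β) *
      MvPolynomial.monomial β (1 : k)]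
    conv_rhs => rw [(H a i).as_sum]
    symm
    simp only [MvPolynomial.C_mul_monomial, mul_one]
    refine Finset.sum_subset ?_ fun α _ hα => by
      rw [MvPolynomial.notMem_support_iff.1 hα, map_zero]
    rw [h.shifts]
    exact Finset.subset_biUnion_of_mem (fun a => (H a i).support) (Finset.mem_univ a)
  have hrow : ∀ a μ, ∑ t : Σ i, S i, (H a t.1).coeff (t.2 : Fin n →₀ ℕ) *
      coeffS (Polynomial.C (MvPolynomial.monomial (t.2 : Fin n →₀ ℕ) 1 * F t.1)) μ =
      coeffS (∑ i, Polynomial.C (H a i * F i)) μ := fun a μ => by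
    rw [Fintype.sum_sigma, coeffS_sum]
    refine Finset.sum_congr rfl fun i _ => ?_
    conv_rhs => rw [← hH a i, Finset.sum_mul, map_sum, coeffS_sum]
    refine Finset.sum_congr rfl fun β _ => ?_
    simp only [coeffS_C, mul_assoc, MvPolynomial.coeff_C_mul]
    split_ifs <;> simp
  have hsum : ∀ a μ, coeffS (∑ i, Polynomial.C (H a i * F i)) μ +
      coeffS ((Polynomial.X - Polynomial.C f) *
        Polynomial.C (MvPolynomial.monomial (B a) 1)) μ =
      (if μ = (1, B a) then 1 else 0) - ∑ b, if μ = (0, B b) then A a b else 0 :=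
    fun a μ => by
    rw [← coeffS_add, add_comm, ← h.relation a, coeffS_sub, coeffS_X_mul_C, coeffS_sum]
    obtain ⟨e, γ⟩ := μ
    simp only [coeffS_C, MvPolynomial.coeff_C_mul, MvPolynomial.coeff_monomial, Prod.mk.injEq,
      eq_comm (a := γ), mul_ite, mul_one, mul_zero, ite_and]
  have hM : ∀ a c, (L.prod * M) (Sum.inr a) c =
      (if Sum.elim (fun e : E => (e : ℕ × (Fin n →₀ ℕ))) (fun b => (0, B b)) c = (1, B a)
        then 1 else 0) - ∑ b, if Sum.elim (fun e : E => (e : ℕ × (Fin n →₀ ℕ)))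
          (fun b => (0, B b)) c = (0, B b) then A a b else 0 := fun a c => by
    rw [← hsum, ← hrow, eL, h.matrix, Matrix.mul_apply, Fintype.sum_sum_type]
    congr 1
    simp [Matrix.one_apply, templateMatrix]
  ext (t | a) (e | b)
  · rw [eL, Matrix.mul_apply, Fintype.sum_sum_type]
    simp [Matrix.one_apply, Matrix.toBlocks₁₁]
  · rw [eL, Matrix.mul_apply, Fintype.sum_sum_type]
    simp [Matrix.one_apply, Matrix.toBlocks₁₂]
  · have he := h.excessive.le e.2
    rw [excessiveMonomials, Finset.mem_sdiff, Finset.mem_union, not_or] at he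
    have h1 : ∀ b, (e : ℕ × (Fin n →₀ ℕ)) ≠ (0, B b) := fun b hb =>
      he.2.1 (Finset.mem_image.2 ⟨b, Finset.mem_univ b, hb.symm⟩)
    have h2 : ∀ b, (e : ℕ × (Fin n →₀ ℕ)) ≠ (1, B b) := fun b hb =>
      he.2.2 (Finset.mem_image.2 ⟨b, Finset.mem_univ b, hb.symm⟩)
    rw [hM]
    simp [h1, h2]
  · rw [hM]
    simp [h.basis.injective.eq_iff]

/-! ### Arithmetic of specializations -/

theorem specializesTo_algebraMap {m : ℕ} (P : Fin m → ℂ) (g : MvPolynomial (Fin m) ℂ) :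
    SpecializesTo P (algebraMap _ (ParamField m) g) (MvPolynomial.eval P g) :=
  ⟨g, 1, by simp, by simp, by simp⟩

theorem SpecializesTo.zero {m : ℕ} (P : Fin m → ℂ) : SpecializesTo P 0 0 := by
  simpa using specializesTo_algebraMap P 0

theorem SpecializesTo.one {m : ℕ} (P : Fin m → ℂ) : SpecializesTo P 1 1 := by
  simpa using specializesTo_algebraMap P 1

theorem ParamField.algebraMap_ne_zero {m : ℕ} {P : Fin m → ℂ} {h : MvPolynomial (Fin m) ℂ}
    (hP : MvPolynomial.eval P h ≠ 0) : algebraMap _ (ParamField m) h ≠ 0 := by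
  rw [map_ne_zero_iff _ (IsFractionRing.injective (MvPolynomial (Fin m) ℂ) (ParamField m))]
  rintro rfl
  simp at hP

theorem SpecializesTo.add {m : ℕ} {P : Fin m → ℂ} {a a' : ParamField m} {b b' : ℂ}
    (h : SpecializesTo P a b) (h' : SpecializesTo P a' b') : SpecializesTo P (a + a') (b + b') := by
  obtain ⟨g, q, hq, rfl, rfl⟩ := h
  obtain ⟨g', q', hq', rfl, rfl⟩ := h'
  refine ⟨g * q' + q * g', q * q', by simp [hq, hq'], ?_, ?_⟩
  · rw [div_add_div _ _ (ParamField.algebraMap_ne_zero hq) (ParamField.algebraMap_ne_zero hq')]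
    simp
  · rw [div_add_div _ _ hq hq']
    simp

theorem SpecializesTo.mul {m : ℕ} {P : Fin m → ℂ} {a a' : ParamField m} {b b' : ℂ}
    (h : SpecializesTo P a b) (h' : SpecializesTo P a' b') : SpecializesTo P (a * a') (b * b') := by
  obtain ⟨g, q, hq, rfl, rfl⟩ := h
  obtain ⟨g', q', hq', rfl, rfl⟩ := h'
  exact ⟨g * g', q * q', by simp [hq, hq'], by simp [div_mul_div_comm],
    by simp [div_mul_div_comm]⟩

theorem SpecializesTo.neg {m : ℕ} {P : Fin m → ℂ} {a : ParamField m} {b : ℂ}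
    (h : SpecializesTo P a b) : SpecializesTo P (-a) (-b) := by
  obtain ⟨g, q, hq, rfl, rfl⟩ := h
  exact ⟨-g, q, hq, by rw [map_neg]; exact (neg_div _ _).symm, by rw [map_neg, neg_div]⟩

theorem SpecializesTo.sub {m : ℕ} {P : Fin m → ℂ} {a a' : ParamField m} {b b' : ℂ}
    (h : SpecializesTo P a b) (h' : SpecializesTo P a' b') : SpecializesTo P (a - a') (b - b') := by
  simpa only [sub_eq_add_neg] using h.add h'.neg

theorem SpecializesTo.inv {m : ℕ} {P : Fin m → ℂ} {a : ParamField m} {b : ℂ}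
    (h : SpecializesTo P a b) (hb : b ≠ 0) : SpecializesTo P a⁻¹ b⁻¹ := by
  obtain ⟨g, q, hq, rfl, rfl⟩ := h
  exact ⟨q, g, (div_ne_zero_iff.1 hb).1, by simp, by simp⟩

theorem SpecializesTo.div {m : ℕ} {P : Fin m → ℂ} {a a' : ParamField m} {b b' : ℂ}
    (h : SpecializesTo P a b) (h' : SpecializesTo P a' b') (hb : b' ≠ 0) :
    SpecializesTo P (a / a') (b / b') := by
  simpa only [div_eq_mul_inv] using h.mul (h'.inv hb)

theorem SpecializesTo.sum {m : ℕ} {P : Fin m → ℂ} {ι : Type*} (s : Finset ι)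
    {a : ι → ParamField m} {b : ι → ℂ} (h : ∀ i ∈ s, SpecializesTo P (a i) (b i)) :
    SpecializesTo P (∑ i ∈ s, a i) (∑ i ∈ s, b i) := by
  classical
  induction s using Finset.induction_on with
  | empty => simpa using SpecializesTo.zero P
  | insert i s hi ih =>
    rw [Finset.sum_insert hi, Finset.sum_insert hi]
    exact (h i (Finset.mem_insert_self i s)).add
      (ih fun j hj => h j (Finset.mem_insert_of_mem hj))

theorem PolySpecializesTo.unique {m n : ℕ} {P : Fin m → ℂ}
    {q : MvPolynomial (Fin n) (ParamField m)} {q' q'' : MvPolynomial (Fin n) ℂ}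
    (h : PolySpecializesTo P q q') (h' : PolySpecializesTo P q q'') : q' = q'' :=
  MvPolynomial.ext _ _ fun α => (h α).unique (h' α)

theorem PolySpecializesTo.zero {m n : ℕ} (P : Fin m → ℂ) :
    PolySpecializesTo (n := n) P 0 0 := fun α => by
  simpa using SpecializesTo.zero P

theorem PolySpecializesTo.monomial {m n : ℕ} {P : Fin m → ℂ} (β : Fin n →₀ ℕ)
    {a : ParamField m} {b : ℂ} (h : SpecializesTo P a b) :
    PolySpecializesTo P (MvPolynomial.monomial β a) (MvPolynomial.monomial β b) := fun α => by
  classical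
  rw [MvPolynomial.coeff_monomial, MvPolynomial.coeff_monomial]
  split_ifs
  exacts [h, SpecializesTo.zero P]

theorem PolySpecializesTo.C {m n : ℕ} {P : Fin m → ℂ} {a : ParamField m} {b : ℂ}
    (h : SpecializesTo P a b) :
    PolySpecializesTo (n := n) P (MvPolynomial.C a) (MvPolynomial.C b) :=
  PolySpecializesTo.monomial 0 h

theorem PolySpecializesTo.add {m n : ℕ} {P : Fin m → ℂ}
    {p q : MvPolynomial (Fin n) (ParamField m)} {p' q' : MvPolynomial (Fin n) ℂ}
    (hp : PolySpecializesTo P p p') (hq : PolySpecializesTo P q q') :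
    PolySpecializesTo P (p + q) (p' + q') := fun α => by
  simpa only [MvPolynomial.coeff_add] using (hp α).add (hq α)

theorem PolySpecializesTo.sub {m n : ℕ} {P : Fin m → ℂ}
    {p q : MvPolynomial (Fin n) (ParamField m)} {p' q' : MvPolynomial (Fin n) ℂ}
    (hp : PolySpecializesTo P p p') (hq : PolySpecializesTo P q q') :
    PolySpecializesTo P (p - q) (p' - q') := fun α => by
  simpa only [MvPolynomial.coeff_sub] using (hp α).sub (hq α)

theorem PolySpecializesTo.mul {m n : ℕ} {P : Fin m → ℂ}
    {p q : MvPolynomial (Fin n) (ParamField m)} {p' q' : MvPolynomial (Fin n) ℂ}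
    (hp : PolySpecializesTo P p p') (hq : PolySpecializesTo P q q') :
    PolySpecializesTo P (p * q) (p' * q') := fun α => by
  classical
  rw [MvPolynomial.coeff_mul, MvPolynomial.coeff_mul]
  exact SpecializesTo.sum _ fun x _ => (hp x.1).mul (hq x.2)

theorem PolySpecializesTo.sum {m n : ℕ} {P : Fin m → ℂ} {ι : Type*} (s : Finset ι)
    {p : ι → MvPolynomial (Fin n) (ParamField m)} {p' : ι → MvPolynomial (Fin n) ℂ}
    (h : ∀ i ∈ s, PolySpecializesTo P (p i) (p' i)) :
    PolySpecializesTo P (∑ i ∈ s, p i) (∑ i ∈ s, p' i) := fun α => by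
  rw [MvPolynomial.coeff_sum, MvPolynomial.coeff_sum]
  exact SpecializesTo.sum s fun i hi => h i hi α

theorem PolySpecializesTo.map {m n : ℕ} (P : Fin m → ℂ)
    (j : MvPolynomial (Fin n) (MvPolynomial (Fin m) ℂ)) :
    PolySpecializesTo P (MvPolynomial.map (algebraMap _ (ParamField m)) j)
      (MvPolynomial.map (MvPolynomial.eval P) j) := fun α => by
  rw [MvPolynomial.coeff_map, MvPolynomial.coeff_map]
  exact specializesTo_algebraMap P _

theorem PolySpecializesTo.exists_lift {m n : ℕ} (P : Fin m → ℂ) (q' : MvPolynomial (Fin n) ℂ) :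
    ∃ q, PolySpecializesTo P q q' := by
  refine ⟨MvPolynomial.map ((algebraMap (MvPolynomial (Fin m) ℂ) (ParamField m)).comp
    MvPolynomial.C) q', fun α => ?_⟩
  rw [MvPolynomial.coeff_map]
  simpa using specializesTo_algebraMap P (MvPolynomial.C (q'.coeff α))

theorem PolySpecializesTo.support_subset {m n : ℕ} {P : Fin m → ℂ}
    {q : MvPolynomial (Fin n) (ParamField m)} {q' : MvPolynomial (Fin n) ℂ}
    (h : PolySpecializesTo P q q') : q'.support ⊆ q.support := fun α hα => by
  rw [MvPolynomial.mem_support_iff] at hα ⊢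
  intro h0
  exact hα ((h0 ▸ h α).unique (SpecializesTo.zero P))

theorem MatrixSpecializesTo.mul {m : ℕ} {P : Fin m → ℂ} {ι κ μ : Type*} [Fintype κ]
    {M : Matrix ι κ (ParamField m)} {N : Matrix κ μ (ParamField m)} {M' : Matrix ι κ ℂ}
    {N' : Matrix κ μ ℂ} (hM : MatrixSpecializesTo P M M') (hN : MatrixSpecializesTo P N N') :
    MatrixSpecializesTo P (M * N) (M' * N') := fun i j => by
  rw [Matrix.mul_apply, Matrix.mul_apply]
  exact SpecializesTo.sum _ fun x _ => (hM i x).mul (hN x j)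

theorem MatrixSpecializesTo.one {m : ℕ} (P : Fin m → ℂ) {ι : Type*} [DecidableEq ι] :
    MatrixSpecializesTo P (1 : Matrix ι ι (ParamField m)) 1 := fun i j => by
  rw [Matrix.one_apply, Matrix.one_apply]
  split_ifs
  exacts [SpecializesTo.one P, SpecializesTo.zero P]

theorem MatrixSpecializesTo.list_prod {m : ℕ} {P : Fin m → ℂ} {ι : Type*} [Fintype ι]
    [DecidableEq ι] {L : List (Matrix ι ι (ParamField m))} {L' : List (Matrix ι ι ℂ)}
    (h : List.Forall₂ (MatrixSpecializesTo P) L L') : MatrixSpecializesTo P L.prod L'.prod := by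
  induction h with
  | nil => exact MatrixSpecializesTo.one P
  | cons h _ ih =>
    rw [List.prod_cons, List.prod_cons]
    exact h.mul ih

/-! ### Generic points -/

/-- The filter of sets of parameters that contain the nonvanishing locus of a nonzero
polynomial. -/
def genericFilter (m : ℕ) : Filter (Fin m → ℂ) where
  sets := {s | ∃ h : MvPolynomial (Fin m) ℂ, h ≠ 0 ∧ ∀ P, MvPolynomial.eval P h ≠ 0 → P ∈ s}
  univ_sets := ⟨1, one_ne_zero, fun _ _ => Set.mem_univ _⟩
  sets_of_superset := fun ⟨h, h0, hs⟩ hst => ⟨h, h0, fun P hP => hst (hs P hP)⟩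
  inter_sets := fun ⟨h, h0, hs⟩ ⟨h', h0', hs'⟩ => ⟨h * h', mul_ne_zero h0 h0', fun P hP => by
    rw [map_mul] at hP
    exact ⟨hs P (left_ne_zero_of_mul hP), hs' P (right_ne_zero_of_mul hP)⟩⟩

theorem eventually_genericFilter_iff {m : ℕ} {p : (Fin m → ℂ) → Prop} :
    (∀ᶠ P in genericFilter m, p P) ↔
      ∃ h : MvPolynomial (Fin m) ℂ, h ≠ 0 ∧ ∀ P, MvPolynomial.eval P h ≠ 0 → p P :=
  Iff.rfl

/-- Two nonvanishing loci of nonzero polynomials meet: the product is nonzero, and over the infinite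
field `ℂ` it does not vanish identically as a function. -/
theorem exists_isZariskiOpen_isZariskiDense {m : ℕ} {p : (Fin m → ℂ) → Prop}
    (hp : ∀ᶠ P in genericFilter m, p P) :
    ∃ U : Set (Fin m → ℂ), IsZariskiOpen U ∧ IsZariskiDense U ∧ ∀ P ∈ U, p P := by
  obtain ⟨h, h0, hh⟩ := eventually_genericFilter_iff.1 hp
  refine ⟨{P | MvPolynomial.eval P h ≠ 0}, ⟨{h}, by simp⟩, ?_, hh⟩
  rintro _ ⟨T, rfl⟩ ⟨P, g, hg, hP⟩
  have hg0 : g ≠ 0 := by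
    rintro rfl
    simp at hP
  have : ∃ Q, MvPolynomial.eval Q (h * g) ≠ 0 := by
    by_contra! H
    exact mul_ne_zero h0 hg0 (MvPolynomial.funext fun Q => by rw [H Q, map_zero])
  obtain ⟨Q, hQ⟩ := this
  rw [map_mul] at hQ
  exact ⟨Q, left_ne_zero_of_mul hQ, g, hg, right_ne_zero_of_mul hQ⟩

/-! ### Generic values of scalars, polynomials and matrices -/

open Classical in
/-- The value of `a` at `P`, or `0` if `a` is not regular there. -/
noncomputable def specialize {m : ℕ} (P : Fin m → ℂ) (a : ParamField m) : ℂ :=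
  if h : ∃ b, SpecializesTo P a b then h.choose else 0

theorem SpecializesTo.specialize_eq {m : ℕ} {P : Fin m → ℂ} {a : ParamField m} {b : ℂ}
    (h : SpecializesTo P a b) : specialize P a = b := by
  have h' : ∃ b, SpecializesTo P a b := ⟨b, h⟩
  rw [specialize, dif_pos h']
  exact h'.choose_spec.unique h

theorem eventually_specializesTo {m : ℕ} (a : ParamField m) :
    ∀ᶠ P in genericFilter m, SpecializesTo P a (specialize P a) := by
  obtain ⟨g, h, hh, rfl⟩ := IsFractionRing.div_surjective (A := MvPolynomial (Fin m) ℂ) a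
  refine eventually_genericFilter_iff.2 ⟨h, nonZeroDivisors.ne_zero hh, fun P hP => ?_⟩
  have : SpecializesTo P (algebraMap _ (ParamField m) g / algebraMap _ (ParamField m) h) _ :=
    ⟨g, h, hP, rfl, rfl⟩
  rwa [this.specialize_eq]

/-- For `a ≠ 0`, both `a` and `a⁻¹` are generically regular, and their values multiply to `1`. -/
theorem eventually_specialize_eq_zero_iff {m : ℕ} (a : ParamField m) :
    ∀ᶠ P in genericFilter m, (specialize P a = 0 ↔ a = 0) := by
  by_cases ha : a = 0
  · subst ha
    exact Filter.Eventually.of_forall fun P => by simp [(SpecializesTo.zero P).specialize_eq]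
  · filter_upwards [eventually_specializesTo a, eventually_specializesTo a⁻¹] with P h h'
    have := (h.mul h').unique (mul_inv_cancel₀ ha ▸ SpecializesTo.one P)
    simp only [ha, iff_false]
    intro h0
    simp [h0] at this

/-- Coefficientwise specialization. -/
noncomputable def specializePoly {m n : ℕ} (P : Fin m → ℂ)
    (q : MvPolynomial (Fin n) (ParamField m)) : MvPolynomial (Fin n) ℂ :=
  ∑ α ∈ q.support, MvPolynomial.monomial α (specialize P (q.coeff α))

theorem coeff_specializePoly {m n : ℕ} (P : Fin m → ℂ)
    (q : MvPolynomial (Fin n) (ParamField m)) (α : Fin n →₀ ℕ) :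
    (specializePoly P q).coeff α = specialize P (q.coeff α) := by
  classical
  rw [specializePoly, MvPolynomial.coeff_sum]
  simp only [MvPolynomial.coeff_monomial, Finset.sum_ite_eq', MvPolynomial.mem_support_iff]
  split_ifs with h
  · rfl
  · rw [not_not.1 h, (SpecializesTo.zero P).specialize_eq]

theorem eventually_polySpecializesTo {m n : ℕ} (q : MvPolynomial (Fin n) (ParamField m)) :
    ∀ᶠ P in genericFilter m, PolySpecializesTo P q (specializePoly P q) := by
  filter_upwards [(Filter.eventually_all_finset q.support).2
    fun α _ => eventually_specializesTo (q.coeff α)] with P h α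
  rw [coeff_specializePoly]
  by_cases hα : α ∈ q.support
  · exact h α hα
  · rw [MvPolynomial.notMem_support_iff.1 hα, (SpecializesTo.zero P).specialize_eq]
    exact SpecializesTo.zero P

/-- Shift sets and excessive monomials are read off from supports, so this keeps them fixed. -/
theorem eventually_support_specializePoly {m n : ℕ} (q : MvPolynomial (Fin n) (ParamField m)) :
    ∀ᶠ P in genericFilter m, (specializePoly P q).support = q.support := by
  filter_upwards [(Filter.eventually_all_finset q.support).2
    fun α _ => eventually_specialize_eq_zero_iff (q.coeff α)] with P h
  ext α
  rw [MvPolynomial.mem_support_iff, coeff_specializePoly, MvPolynomial.mem_support_iff]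
  by_cases hα : α ∈ q.support
  · rw [Ne, h α hα]
  · simp [MvPolynomial.notMem_support_iff.1 hα, (SpecializesTo.zero P).specialize_eq]

theorem eventually_matrixSpecializesTo {m : ℕ} {ι κ : Type*} [Finite ι] [Finite κ]
    (M : Matrix ι κ (ParamField m)) :
    ∀ᶠ P in genericFilter m, MatrixSpecializesTo P M (M.map (specialize P)) :=
  Filter.eventually_all.2 fun i => Filter.eventually_all.2 fun j =>
    eventually_specializesTo (M i j)

/-- Only row scalings impose a condition, namely that the scalar stay nonzero. -/
theorem eventually_isElementaryMatrix {m : ℕ} {ι : Type*} [DecidableEq ι]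
    {T : Matrix ι ι (ParamField m)} (hT : IsElementaryMatrix T) :
    ∀ᶠ P in genericFilter m, IsElementaryMatrix (T.map (specialize P)) := by
  have h0 := fun P : Fin m → ℂ => (SpecializesTo.zero P).specialize_eq
  have h1 := fun P : Fin m → ℂ => (SpecializesTo.one P).specialize_eq
  rcases hT with ⟨i, j, hij, c, rfl⟩ | ⟨i, c, hc, rfl⟩ | ⟨i, j, hij, rfl⟩
  · refine Filter.Eventually.of_forall fun P => Or.inl ⟨i, j, hij, specialize P c, ?_⟩
    ext a b
    simp only [Matrix.map_apply, Matrix.transvection, Matrix.add_apply, Matrix.one_apply,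
      Matrix.single_apply]
    by_cases hab : a = b
    · have : ¬ (i = a ∧ j = b) := fun h => hij (h.1.trans (hab.trans h.2.symm))
      simp [hab, hab ▸ this, h1]
    · simp only [hab, if_false, zero_add]
      split_ifs <;> simp [h0]
  · filter_upwards [eventually_specialize_eq_zero_iff c] with P hP
    refine Or.inr (Or.inl ⟨i, specialize P c, fun h => hc (hP.1 h), ?_⟩)
    ext a b
    rw [Matrix.map_apply, Matrix.diagonal_apply, Matrix.diagonal_apply, Function.update_apply,
      Function.update_apply]
    split_ifs <;> simp [h0, h1]
  · refine Filter.Eventually.of_forall fun P => Or.inr (Or.inr ⟨i, j, hij, ?_⟩)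
    ext a b
    simp only [Matrix.map_apply, Matrix.swap, Equiv.Perm.permMatrix, PEquiv.toMatrix_apply]
    split_ifs <;> simp [h0, h1]

/-! ### Specialization of ideals -/

/-- The specializations already form an ideal: a multiplier in `ℂ[x]` lifts to `ℂ(p)[x]` with
constant coefficients. -/
theorem mem_specializedIdeal_iff {m n : ℕ} {P : Fin m → ℂ}
    {I : Ideal (MvPolynomial (Fin n) (ParamField m))} {q' : MvPolynomial (Fin n) ℂ} :
    q' ∈ specializedIdeal P I ↔ ∃ q ∈ I, PolySpecializesTo P q q' := by
  refine ⟨fun h => ?_, fun h => Ideal.subset_span h⟩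
  induction h using Submodule.span_induction with
  | mem x hx => exact hx
  | zero => exact ⟨0, I.zero_mem, PolySpecializesTo.zero P⟩
  | add x y _ _ hx hy =>
    obtain ⟨p, hp, hp'⟩ := hx
    obtain ⟨q, hq, hq'⟩ := hy
    exact ⟨p + q, I.add_mem hp hq, hp'.add hq'⟩
  | smul a x _ hx =>
    obtain ⟨p, hp, hp'⟩ := hx
    obtain ⟨b, hb⟩ := PolySpecializesTo.exists_lift P a
    exact ⟨b * p, I.mul_mem_left b hp, hb.mul hp'⟩

/-- Clearing denominators: `ℂ(p)[x]` is the localization of `ℂ[p][x]` at the nonzero elements of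
`ℂ[p]`. -/
theorem exists_C_mul_eq_map_of_mem_extendedIdeal {m n : ℕ}
    {J : Ideal (MvPolynomial (Fin n) (MvPolynomial (Fin m) ℂ))}
    {q : MvPolynomial (Fin n) (ParamField m)} (hq : q ∈ extendedIdeal J) :
    ∃ c : ParamField m, c ≠ 0 ∧ ∃ j ∈ J,
      MvPolynomial.C c * q = MvPolynomial.map (algebraMap _ (ParamField m)) j := by
  let : Algebra (MvPolynomial (Fin n) (MvPolynomial (Fin m) ℂ))
      (MvPolynomial (Fin n) (ParamField m)) := MvPolynomial.algebraMvPolynomial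
  have h := (IsLocalization.mem_map_algebraMap_iff
    ((nonZeroDivisors (MvPolynomial (Fin m) ℂ)).map (MvPolynomial.C (σ := Fin n)))
    (MvPolynomial (Fin n) (ParamField m))).1 hq
  obtain ⟨⟨⟨j, hj⟩, ⟨_, c, hc, rfl⟩⟩, e⟩ := h
  refine ⟨algebraMap _ _ c, ?_, j, hj, ?_⟩
  · rw [map_ne_zero_iff _ (IsFractionRing.injective (MvPolynomial (Fin m) ℂ) (ParamField m))]
    exact nonZeroDivisors.ne_zero hc
  · rw [mul_comm, ← MvPolynomial.map_C]
    exact e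

/-- An ideal has a finite subset whose leading monomials generate its initial ideal. -/
theorem exists_finset_degree_le {n : ℕ} {k : Type*} [Field k]
    (ord : MonomialOrder.{0, u} (Fin n)) (I : Ideal (MvPolynomial (Fin n) k)) :
    ∃ G : Finset (MvPolynomial (Fin n) k), (∀ g ∈ G, g ∈ I ∧ g ≠ 0) ∧
      ∀ q ∈ I, q ≠ 0 → ∃ g ∈ G, ord.degree g ≤ ord.degree q := by
  classical
  set D : Set (Fin n →₀ ℕ) := {α | ∃ q ∈ I, q ≠ 0 ∧ ord.degree q = α} with hD
  -- Dickson's lemma: minimal exponents form an antichain in the well-quasi-order on `Fin n →₀ ℕ`.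
  have hfin : {α | Minimal (· ∈ D) α}.Finite :=
    WellQuasiOrderedLE.finite_of_isAntichain (setOfPred_minimal_antichain (· ∈ D))
  have hex : ∀ α ∈ D, ∃ q ∈ I, q ≠ 0 ∧ ord.degree q = α := fun α h => h
  choose! s hs hs0 hsd using hex
  refine ⟨hfin.toFinset.image s, fun g hg => ?_, fun q hq hq0 => ?_⟩
  · obtain ⟨α, hα, rfl⟩ := Finset.mem_image.1 hg
    have hα' : α ∈ D := ((Set.Finite.mem_toFinset hfin).1 hα).prop
    exact ⟨hs α hα', hs0 α hα'⟩
  · have hqD : ord.degree q ∈ D := ⟨q, hq, hq0, rfl⟩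
    obtain ⟨β, hβ, hmin⟩ := exists_minimal_le_of_wellFoundedLT (· ∈ D) _ hqD
    refine ⟨s β, Finset.mem_image_of_mem s ((Set.Finite.mem_toFinset hfin).2 hmin), ?_⟩
    rwa [hsd β hmin.prop]

/-- Scaling by a nonzero constant keeps the leading monomial, so the finite set can be moved into
`J`, whose elements are regular at every point. -/
theorem exists_finset_subset_degree_le {m n : ℕ} (ord : MonomialOrder.{0, u} (Fin n))
    (J : Ideal (MvPolynomial (Fin n) (MvPolynomial (Fin m) ℂ))) :
    ∃ G : Finset (MvPolynomial (Fin n) (MvPolynomial (Fin m) ℂ)),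
      (∀ g ∈ G, g ∈ J ∧ MvPolynomial.map (algebraMap _ (ParamField m)) g ≠ 0) ∧
      ∀ q ∈ extendedIdeal J, q ≠ 0 → ∃ g ∈ G,
        ord.degree (MvPolynomial.map (algebraMap _ (ParamField m)) g) ≤ ord.degree q := by
  classical
  obtain ⟨G, hG, hdeg⟩ := exists_finset_degree_le ord (extendedIdeal J)
  choose! c hc j hj e using fun q (hq : q ∈ extendedIdeal J) =>
    exists_C_mul_eq_map_of_mem_extendedIdeal hq
  refine ⟨G.image j, fun g hg => ?_, fun q hq hq0 => ?_⟩
  · obtain ⟨p, hp, rfl⟩ := Finset.mem_image.1 hg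
    have hpI := (hG p hp).1
    refine ⟨hj p hpI, ?_⟩
    rw [← e p hpI]
    exact mul_ne_zero (by simpa using hc p hpI) (hG p hp).2
  · obtain ⟨p, hp, hle⟩ := hdeg q hq hq0
    have hpI := (hG p hp).1
    refine ⟨j p, Finset.mem_image_of_mem j hp, ?_⟩
    rwa [← e p hpI, ord.degree_mul (by simpa using hc p hpI) (hG p hp).2, ord.degree_C, zero_add]

/-- Specialization can only shrink the support, so the degree is kept once the leading coefficient
survives. -/
theorem PolySpecializesTo.degree_eq {m n : ℕ} (ord : MonomialOrder.{0, u} (Fin n))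
    {P : Fin m → ℂ} {q : MvPolynomial (Fin n) (ParamField m)} {q' : MvPolynomial (Fin n) ℂ}
    (h : PolySpecializesTo P q q') (h0 : q'.coeff (ord.degree q) ≠ 0) :
    ord.degree q' = ord.degree q := by
  apply ord.toSyn.injective
  apply le_antisymm
  · exact ord.degree_le_iff.2 fun α hα => ord.le_degree (h.support_subset hα)
  · exact ord.le_degree (MvPolynomial.mem_support_iff.2 h0)

/-- Division by a finite set `G` of elements of `I` whose leading monomials generate the initial
ideal and whose leading coefficients do not vanish at `P`. -/
theorem PolySpecializesTo.mem_and_degree_of_mem {m n : ℕ} (ord : MonomialOrder.{0, u} (Fin n))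
    {P : Fin m → ℂ} {I : Ideal (MvPolynomial (Fin n) (ParamField m))}
    {K : Ideal (MvPolynomial (Fin n) ℂ)}
    (hG : ∀ q ∈ I, q ≠ 0 → ∃ g ∈ I, ord.degree g ≤ ord.degree q ∧ ∃ g' ∈ K,
      PolySpecializesTo P g g' ∧ g'.coeff (ord.degree g) ≠ 0)
    {q : MvPolynomial (Fin n) (ParamField m)} (hq : q ∈ I) {q' : MvPolynomial (Fin n) ℂ}
    (h : PolySpecializesTo P q q') :
    q' ∈ K ∧ (q' ≠ 0 → ∃ g ∈ I, g ≠ 0 ∧ ord.degree g = ord.degree q') := by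
  induction hs : ord.toSyn (ord.degree q) using WellFoundedLT.induction generalizing q q' with
  | _ s ih =>
  by_cases h0 : q = 0
  · have : q' = 0 := h.unique (h0 ▸ PolySpecializesTo.zero P)
    simp [this]
  obtain ⟨g, hgI, hle, g', hg'K, hg, hg'0⟩ := hG q hq h0
  have hg0 : g ≠ 0 := by
    rintro rfl
    exact hg'0 (by rw [hg.unique (PolySpecializesTo.zero P), MvPolynomial.coeff_zero])
  -- The divisor's leading coefficient is nonzero at `P`, so the quotient term, and with it the
  -- remainder, is regular at `P`.
  have hc : SpecializesTo P (ord.leadingCoeff q / ord.leadingCoeff g)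
      (q'.coeff (ord.degree q) / g'.coeff (ord.degree g)) := (h _).div (hg _) hg'0
  have h1 := h.sub ((PolySpecializesTo.monomial (ord.degree q - ord.degree g) hc).mul hg)
  have key := fun H => ih _ (hs ▸ H) (I.sub_mem hq (I.mul_mem_left _ hgI)) h1 rfl
  rcases ord.reduce_eq_zero_or_degree_lt h0 hg0 hle with H | H
  · have e := sub_eq_zero.1 (h1.unique (H ▸ PolySpecializesTo.zero P))
    refine ⟨e ▸ K.mul_mem_left _ hg'K, fun hq' => ?_⟩
    have hne : q'.coeff (ord.degree q) ≠ 0 := fun hz => hq' (by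
      rw [e, hz, zero_div, map_zero, zero_mul])
    exact ⟨q, hq, h0, (h.degree_eq ord hne).symm⟩
  · obtain ⟨h2, h3⟩ := key H
    refine ⟨(Submodule.sub_mem_iff_left K (K.mul_mem_left _ hg'K)).1 h2, fun hq' => ?_⟩
    -- If the leading coefficient of `q` vanishes at `P`, the subtracted term specializes to zero:
    -- the remainder still specializes to `q'` and induction applies. Otherwise `q` itself is the
    -- witness.
    by_cases hz : q'.coeff (ord.degree q) = 0
    · rw [hz, zero_div, map_zero, zero_mul, sub_zero] at h3
      exact h3 hq'
    · exact ⟨q, hq, h0, (h.degree_eq ord hz).symm⟩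

theorem standardExponents_specializedIdeal {m n : ℕ} (ord : MonomialOrder.{0, u} (Fin n))
    {P : Fin m → ℂ} {I : Ideal (MvPolynomial (Fin n) (ParamField m))}
    (hG : ∀ q ∈ I, q ≠ 0 → ∃ g ∈ I, ord.degree g ≤ ord.degree q ∧ ∃ g',
      PolySpecializesTo P g g' ∧ g'.coeff (ord.degree g) ≠ 0) :
    standardExponents ord (specializedIdeal P I) = standardExponents ord I := by
  ext α
  refine not_congr ?_
  rw [monomial_mem_initialIdeal_iff, monomial_mem_initialIdeal_iff]
  constructor
  · rintro ⟨q', hq', hq'0, hle⟩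
    obtain ⟨q, hq, h⟩ := mem_specializedIdeal_iff.1 hq'
    -- With `K = ⊤` membership is vacuous; only the statement on degrees is needed.
    obtain ⟨g, hg, hg0, e⟩ := (h.mem_and_degree_of_mem ord (K := ⊤)
      (fun q hq hq0 => by simpa using hG q hq hq0) hq).2 hq'0
    exact ⟨g, hg, hg0, e.trans_le hle⟩
  · rintro ⟨q, hq, hq0, hle⟩
    obtain ⟨g, hg, hgle, g', hgg', h0⟩ := hG q hq hq0
    refine ⟨g', mem_specializedIdeal_iff.2 ⟨g, hg, hgg'⟩, ?_, ?_⟩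
    · rintro rfl
      simp at h0
    · rw [hgg'.degree_eq ord h0]
      exact hgle.trans hle

/-- Generically, the specialized ideal is generated by the specializations of given generators,
equals the specialization of the integral model, and has the same standard monomials. -/
theorem eventually_specializedIdeal {m n r : ℕ} (ord : MonomialOrder.{0, u} (Fin n))
    (J : Ideal (MvPolynomial (Fin n) (MvPolynomial (Fin m) ℂ)))
    (F : Fin r → MvPolynomial (Fin n) (ParamField m))
    (hF : Ideal.span (Set.range F) = extendedIdeal J) :
    ∀ᶠ P in genericFilter m,
      specializedIdeal P (extendedIdeal J) = J.map (MvPolynomial.map (MvPolynomial.eval P)) ∧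
      Ideal.span (Set.range fun i => specializePoly P (F i)) =
        specializedIdeal P (extendedIdeal J) ∧
      standardExponents ord (specializedIdeal P (extendedIdeal J)) =
        standardExponents ord (extendedIdeal J) := by
  classical
  obtain ⟨G, hG, hdeg⟩ := exists_finset_subset_degree_le ord J
  set φ := MvPolynomial.map (σ := Fin n) (algebraMap (MvPolynomial (Fin m) ℂ) (ParamField m))
    with hφ
  have hGI : ∀ g ∈ J, φ g ∈ extendedIdeal J := fun g hg => Ideal.mem_map_of_mem _ hg
  -- Only the cofactors of the finitely many `g ∈ G` must be regular at `P`, not those of every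
  -- element of the ideal.
  have hcomb : ∀ g ∈ G, ∃ c : Fin r → MvPolynomial (Fin n) (ParamField m),
      ∑ i, c i * F i = φ g := fun g hg => by
    rw [← Ideal.mem_span_range_iff_exists_fun, hF]
    exact hGI g (hG g hg).1
  choose! c hc using hcomb
  filter_upwards [Filter.eventually_all.2 fun i => eventually_polySpecializesTo (F i),
    (Filter.eventually_all_finset G).2 fun g _ => Filter.eventually_all.2 fun i =>
      eventually_polySpecializesTo (c g i),
    (Filter.eventually_all_finset G).2 fun g _ =>
      eventually_specialize_eq_zero_iff (ord.leadingCoeff (φ g))] with P hFP hcP hlc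
  have hlead : ∀ g ∈ G, (MvPolynomial.map (MvPolynomial.eval P) g).coeff (ord.degree (φ g)) ≠ 0 :=
    fun g hg hz => by
      refine ord.leadingCoeff_ne_zero_iff.2 (hG g hg).2 ((hlc g hg).1 ?_)
      rw [← hz]
      exact (PolySpecializesTo.map P g _).specialize_eq
  -- Division by `G`, used twice: with `K` the image of `J`, and with `K` generated by the
  -- specialized `F`.
  have hK : ∀ K : Ideal (MvPolynomial (Fin n) ℂ),
      (∀ g ∈ G, MvPolynomial.map (MvPolynomial.eval P) g ∈ K) →
      specializedIdeal P (extendedIdeal J) ≤ K := fun K hGK q' hq' => by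
    obtain ⟨q, hq, h⟩ := mem_specializedIdeal_iff.1 hq'
    refine (h.mem_and_degree_of_mem ord (fun q hq hq0 => ?_) hq).1
    obtain ⟨g, hg, hle⟩ := hdeg q hq hq0
    exact ⟨φ g, hGI g (hG g hg).1, hle, _, hGK g hg, PolySpecializesTo.map P g, hlead g hg⟩
  refine ⟨le_antisymm (hK _ fun g hg => Ideal.mem_map_of_mem _ (hG g hg).1) ?_,
    le_antisymm ?_ (hK _ fun g hg => ?_), standardExponents_specializedIdeal ord
      fun q hq hq0 => ?_⟩
  · refine Ideal.map_le_iff_le_comap.2 fun j hj => mem_specializedIdeal_iff.2 ?_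
    exact ⟨φ j, hGI j hj, PolySpecializesTo.map P j⟩
  · rw [Ideal.span_le]
    rintro _ ⟨i, rfl⟩
    exact mem_specializedIdeal_iff.2 ⟨F i, hF ▸ Ideal.subset_span ⟨i, rfl⟩, hFP i⟩
  · have h1 := PolySpecializesTo.sum Finset.univ fun i _ => (hcP g hg i).mul (hFP i)
    rw [hc g hg] at h1
    rw [(PolySpecializesTo.map P g).unique h1]
    exact Ideal.sum_mem _ fun i _ => Ideal.mul_mem_left _ _ (Ideal.subset_span ⟨i, rfl⟩)
  · obtain ⟨g, hg, hle⟩ := hdeg q hq hq0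
    exact ⟨φ g, hGI g (hG g hg).1, hle, _, PolySpecializesTo.map P g, hlead g hg⟩

/-! ### Specialization of templates -/

theorem support_monomial_mul_congr {n : ℕ} {k k' : Type*} [Field k] [Field k']
    {p : MvPolynomial (Fin n) k} {p' : MvPolynomial (Fin n) k'} (h : p'.support = p.support)
    (β : Fin n →₀ ℕ) : (MvPolynomial.monomial β 1 * p').support =
      (MvPolynomial.monomial β 1 * p).support := by
  ext α
  rw [MvPolynomial.mem_support_iff, MvPolynomial.mem_support_iff,
    MvPolynomial.coeff_monomial_mul', MvPolynomial.coeff_monomial_mul']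
  split_ifs
  · rw [one_mul, one_mul, ← MvPolynomial.mem_support_iff, ← MvPolynomial.mem_support_iff, h]
  · simp

theorem shiftSet_congr {n d r : ℕ} {k k' : Type*} [Field k] [Field k']
    {H : Matrix (Fin d) (Fin r) (MvPolynomial (Fin n) k)}
    {H' : Matrix (Fin d) (Fin r) (MvPolynomial (Fin n) k')}
    (h : ∀ a i, (H' a i).support = (H a i).support) : shiftSet H' = shiftSet H := by
  funext i
  simp only [shiftSet, h]

theorem excessiveMonomials_congr {n d r : ℕ} {k k' : Type*} [Field k] [Field k']
    {F : Fin r → MvPolynomial (Fin n) k} {F' : Fin r → MvPolynomial (Fin n) k'}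
    {H : Matrix (Fin d) (Fin r) (MvPolynomial (Fin n) k)}
    {H' : Matrix (Fin d) (Fin r) (MvPolynomial (Fin n) k')}
    (hF : ∀ i, (F' i).support = (F i).support)
    (h : ∀ a i, (H' a i).support = (H a i).support) (B : Fin d → (Fin n →₀ ℕ)) :
    excessiveMonomials F' B H' = excessiveMonomials F B H := by
  simp only [excessiveMonomials, templateMonomials, shiftSet_congr h,
    fun i => support_monomial_mul_congr (hF i)]

theorem PolySpecializesTo.coeffS_C {m n : ℕ} {P : Fin m → ℂ}
    {q : MvPolynomial (Fin n) (ParamField m)} {q' : MvPolynomial (Fin n) ℂ}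
    (h : PolySpecializesTo P q q') (μ : ℕ × (Fin n →₀ ℕ)) :
    SpecializesTo P (coeffS (Polynomial.C q) μ) (coeffS (Polynomial.C q') μ) := by
  rw [_root_.coeffS_C, _root_.coeffS_C]
  split_ifs
  exacts [h _, SpecializesTo.zero P]

theorem PolySpecializesTo.coeffS_X_mul_C {m n : ℕ} {P : Fin m → ℂ}
    {q : MvPolynomial (Fin n) (ParamField m)} {q' : MvPolynomial (Fin n) ℂ}
    (h : PolySpecializesTo P q q') (μ : ℕ × (Fin n →₀ ℕ)) :
    SpecializesTo P (coeffS (Polynomial.X * Polynomial.C q) μ)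
      (coeffS (Polynomial.X * Polynomial.C q') μ) := by
  rw [_root_.coeffS_X_mul_C, _root_.coeffS_X_mul_C]
  split_ifs
  exacts [h _, SpecializesTo.zero P]

theorem MatrixSpecializesTo.templateMatrix {m n d r : ℕ} {P : Fin m → ℂ}
    {f : MvPolynomial (Fin n) (ParamField m)} {f' : MvPolynomial (Fin n) ℂ}
    {F : Fin r → MvPolynomial (Fin n) (ParamField m)} {F' : Fin r → MvPolynomial (Fin n) ℂ}
    (hf : PolySpecializesTo P f f') (hF : ∀ i, PolySpecializesTo P (F i) (F' i))
    (B : Fin d → (Fin n →₀ ℕ)) (S : Fin r → Finset (Fin n →₀ ℕ))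
    (E : Finset (ℕ × (Fin n →₀ ℕ))) :
    MatrixSpecializesTo P (templateMatrix f F B S E) (templateMatrix f' F' B S E) := by
  rintro (t | a) c
  · exact ((PolySpecializesTo.monomial _ (SpecializesTo.one P)).mul (hF t.1)).coeffS_C _
  · have hB := PolySpecializesTo.monomial (B a) (SpecializesTo.one P)
    simp only [_root_.templateMatrix, Matrix.of_apply, Sum.elim_inr, sub_mul, coeffS_sub,
      ← Polynomial.C_mul]
    exact (hB.coeffS_X_mul_C _).sub ((hf.mul hB).coeffS_C _)

theorem MatrixSpecializesTo.unique {m : ℕ} {P : Fin m → ℂ} {ι κ : Type*}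
    {M : Matrix ι κ (ParamField m)} {M' M'' : Matrix ι κ ℂ}
    (h : MatrixSpecializesTo P M M') (h' : MatrixSpecializesTo P M M'') : M' = M'' :=
  Matrix.ext fun i j => (h i j).unique (h' i j)

/-- Elimination templates specialize generically. -/
theorem IsEliminationTemplate.eventually_specialize {m n d r : ℕ}
    {ord : MonomialOrder.{0, u} (Fin n)}
    {J : Ideal (MvPolynomial (Fin n) (MvPolynomial (Fin m) ℂ))}
    {f : MvPolynomial (Fin n) (ParamField m)}
    {F : Fin r → MvPolynomial (Fin n) (ParamField m)}
    {B : Fin d → (Fin n →₀ ℕ)} {A : Matrix (Fin d) (Fin d) (ParamField m)}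
    {H : Matrix (Fin d) (Fin r) (MvPolynomial (Fin n) (ParamField m))}
    {S : Fin r → Finset (Fin n →₀ ℕ)} {E : Finset (ℕ × (Fin n →₀ ℕ))}
    {M : Matrix ((Σ i, S i) ⊕ Fin d) (E ⊕ Fin d) (ParamField m)}
    (h : IsEliminationTemplate ord (extendedIdeal J) f F B A H S E M) :
    ∀ᶠ P in genericFilter m,
      specializedIdeal P (extendedIdeal J) = J.map (MvPolynomial.map (MvPolynomial.eval P)) ∧
      PolySpecializesTo P f (specializePoly P f) ∧
      (∀ i, PolySpecializesTo P (F i) (specializePoly P (F i))) ∧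
      (∀ a i, PolySpecializesTo P (H a i) (specializePoly P (H a i))) ∧
      MatrixSpecializesTo P A (A.map (specialize P)) ∧
      MatrixSpecializesTo P M (M.map (specialize P)) ∧
      IsEliminationTemplate ord (specializedIdeal P (extendedIdeal J)) (specializePoly P f)
        (fun i => specializePoly P (F i)) B (A.map (specialize P))
        (H.map (specializePoly P)) S E (M.map (specialize P)) := by
  filter_upwards [eventually_specializedIdeal ord J F h.generators,
    eventually_polySpecializesTo f,
    Filter.eventually_all.2 fun i => eventually_polySpecializesTo (F i),
    Filter.eventually_all.2 fun a => Filter.eventually_all.2 fun i =>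
      eventually_polySpecializesTo (H a i),
    eventually_matrixSpecializesTo A, eventually_matrixSpecializesTo M,
    Filter.eventually_all.2 fun i => eventually_support_specializePoly (F i),
    Filter.eventually_all.2 fun a => Filter.eventually_all.2 fun i =>
      eventually_support_specializePoly (H a i)]
    with P ⟨hJ, hspan, hstd⟩ hf hF hH hA hM hFs hHs
  -- The ordering of `B` does not involve the field; only the set of standard exponents has to be
  -- compared.
  have hB : IsStandardBasis ord (specializedIdeal P (extendedIdeal J)) B :=
    ⟨h.basis.1, h.basis.2.trans hstd.symm⟩
  have hrel : ∀ a, ∑ i, specializePoly P (H a i) * specializePoly P (F i) =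
      specializePoly P f * MvPolynomial.monomial (B a) 1 -
        ∑ b, MvPolynomial.C (A.map (specialize P) a b) * MvPolynomial.monomial (B b) 1 :=
    fun a => by
    have hB := fun a => PolySpecializesTo.monomial (B a) (SpecializesTo.one P)
    have h1 := PolySpecializesTo.sum Finset.univ fun i _ => (hH a i).mul (hF i)
    rw [(template_relation_iff f F B A H a).1 (h.relation a)] at h1
    exact h1.unique ((hf.mul (hB a)).sub
      (PolySpecializesTo.sum Finset.univ fun b _ => (PolySpecializesTo.C (hA a b)).mul (hB b)))
  refine ⟨hJ, hf, hF, hH, hA, hM, hB.isZeroDimensional, hspan, hB,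
    (isActionMatrix_iff _ _ _ _).2 fun a => ?_,
    fun a => (template_relation_iff _ _ _ _ _ a).2 (hrel a),
    h.shifts.trans (shiftSet_congr hHs).symm,
    h.excessive.trans (excessiveMonomials_congr hFs hHs B).symm, hM.unique ?_⟩
  -- The specialized relation exhibits the difference as a combination of the specialized
  -- generators, so `A` at `P` is the action matrix.
  · rw [← hrel a, ← hspan]
    exact Ideal.sum_mem _ fun i _ => Ideal.mul_mem_left _ _ (Ideal.subset_span ⟨i, rfl⟩)
  · rw [h.matrix]
    exact MatrixSpecializesTo.templateMatrix hf hF B S E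

/-- Reductions of templates specialize generically. -/
theorem IsTemplateReduction.eventually_specialize {m d : ℕ} {ι κ : Type*} [Fintype ι]
    [DecidableEq ι] [Finite κ] {M : Matrix (ι ⊕ Fin d) (κ ⊕ Fin d) (ParamField m)}
    {A : Matrix (Fin d) (Fin d) (ParamField m)}
    {L : List (Matrix (ι ⊕ Fin d) (ι ⊕ Fin d) (ParamField m))}
    (h : IsTemplateReduction M A L) :
    ∀ᶠ P in genericFilter m,
      List.Forall₂ (MatrixSpecializesTo P) L (L.map fun T => T.map (specialize P)) ∧
      IsTemplateReduction (M.map (specialize P)) (A.map (specialize P))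
        (L.map fun T => T.map (specialize P)) ∧
      MatrixSpecializesTo P (L.prod * M)
        ((L.map fun T => T.map (specialize P)).prod * M.map (specialize P)) ∧
      ∀ i j, ((L.map fun T => T.map (specialize P)).prod * M.map (specialize P)) i j = 0 ↔
        (L.prod * M) i j = 0 := by
  classical
  obtain ⟨X, Y, hXY⟩ := h.block
  filter_upwards [eventually_matrixSpecializesTo A, eventually_matrixSpecializesTo M,
    (Filter.eventually_all_finset L.toFinset).2 fun T _ => eventually_matrixSpecializesTo T,
    (Filter.eventually_all_finset L.toFinset).2 fun T hT =>
      eventually_isElementaryMatrix (h.elementary T (List.mem_toFinset.1 hT)),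
    Filter.eventually_all.2 fun i => Filter.eventually_all.2 fun j =>
      eventually_specialize_eq_zero_iff ((L.prod * M) i j)] with P hA hM hL hLe hz
  have hL' : List.Forall₂ (MatrixSpecializesTo P) L (L.map fun T => T.map (specialize P)) := by
    rw [List.forall₂_map_right_iff, List.forall₂_same]
    exact fun T hT => hL T (List.mem_toFinset.2 hT)
  have hprod := (MatrixSpecializesTo.list_prod hL').mul hM
  refine ⟨hL', ⟨?_, Matrix.toBlocks₁₁
      ((L.map fun T => T.map (specialize P)).prod * M.map (specialize P)), Matrix.toBlocks₁₂
      ((L.map fun T => T.map (specialize P)).prod * M.map (specialize P)), ?_⟩, hprod,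
    fun i j => ?_⟩
  · intro T hT
    obtain ⟨T', hT', rfl⟩ := List.mem_map.1 hT
    exact hLe T' (List.mem_toFinset.2 hT')
  · ext (i | i) (j | j)
    · rfl
    · rfl
    -- The lower blocks are forced: values at `P` are unique, and the generic blocks are `0` and
    -- `-A`.
    · refine (hprod _ _).unique ?_
      rw [hXY]
      exact SpecializesTo.zero P
    · refine (hprod _ _).unique ?_
      rw [hXY]
      exact (hA i j).neg
  · rw [← (hprod i j).specialize_eq]
    exact hz i j

/-! ### Assembly of the theorem -/

theorem mainTheorem2 (m n : ℕ)
    (J : Ideal (MvPolynomial (Fin n) (MvPolynomial (Fin m) ℂ)))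
    (hJ : J.comap (MvPolynomial.C : MvPolynomial (Fin m) ℂ →+* _) = ⊥)
    (hzero : IsZeroDimensional (extendedIdeal J))
    (ord : MonomialOrder.{0, u} (Fin n)) :
    -- every action polynomial and every finite generating family admit a template
    (∀ (f : MvPolynomial (Fin n) (ParamField m)) (r : ℕ)
        (F : Fin r → MvPolynomial (Fin n) (ParamField m)),
      Ideal.span (Set.range F) = extendedIdeal J →
      ∃ (d : ℕ) (B : Fin d → (Fin n →₀ ℕ)) (A : Matrix (Fin d) (Fin d) (ParamField m))
        (H : Matrix (Fin d) (Fin r) (MvPolynomial (Fin n) (ParamField m)))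
        (S : Fin r → Finset (Fin n →₀ ℕ)) (E : Finset (ℕ × (Fin n →₀ ℕ)))
        (M : Matrix ((Σ i, S i) ⊕ Fin d) (E ⊕ Fin d) (ParamField m)),
        IsEliminationTemplate ord (extendedIdeal J) f F B A H S E M) ∧
    -- every template
    (∀ (d r : ℕ) (f : MvPolynomial (Fin n) (ParamField m))
        (F : Fin r → MvPolynomial (Fin n) (ParamField m))
        (B : Fin d → (Fin n →₀ ℕ)) (A : Matrix (Fin d) (Fin d) (ParamField m))
        (H : Matrix (Fin d) (Fin r) (MvPolynomial (Fin n) (ParamField m)))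
        (S : Fin r → Finset (Fin n →₀ ℕ)) (E : Finset (ℕ × (Fin n →₀ ℕ)))
        (M : Matrix ((Σ i, S i) ⊕ Fin d) (E ⊕ Fin d) (ParamField m)),
      IsEliminationTemplate ord (extendedIdeal J) f F B A H S E M →
      -- can be reduced by elementary row operations,
      (∃ L, IsTemplateReduction M A L) ∧
      -- and it specializes generically, together with any such reduction
      ∀ L, IsTemplateReduction M A L →
        ∃ U : Set (Fin m → ℂ), IsZariskiOpen U ∧ IsZariskiDense U ∧ ∀ P ∈ U,
          specializedIdeal P (extendedIdeal J) =
            J.map (MvPolynomial.map (MvPolynomial.eval P)) ∧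
          ∃ (f' : MvPolynomial (Fin n) ℂ) (F' : Fin r → MvPolynomial (Fin n) ℂ)
            (A' : Matrix (Fin d) (Fin d) ℂ)
            (H' : Matrix (Fin d) (Fin r) (MvPolynomial (Fin n) ℂ))
            (M' : Matrix ((Σ i, S i) ⊕ Fin d) (E ⊕ Fin d) ℂ)
            (L' : List (Matrix ((Σ i, S i) ⊕ Fin d) ((Σ i, S i) ⊕ Fin d) ℂ)),
            PolySpecializesTo P f f' ∧
            (∀ i, PolySpecializesTo P (F i) (F' i)) ∧
            (∀ a i, PolySpecializesTo P (H a i) (H' a i)) ∧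
            MatrixSpecializesTo P A A' ∧
            MatrixSpecializesTo P M M' ∧
            List.Forall₂ (MatrixSpecializesTo P) L L' ∧
            IsEliminationTemplate ord (specializedIdeal P (extendedIdeal J))
              f' F' B A' H' S E M' ∧
            IsTemplateReduction M' A' L' ∧
            MatrixSpecializesTo P (L.prod * M) (L'.prod * M') ∧
            ∀ i j, (L'.prod * M') i j = 0 ↔ (L.prod * M) i j = 0) := by
  refine ⟨fun f r F hF => exists_isEliminationTemplate ord hzero f F hF,
    fun d r f F B A H S E M h => ⟨h.exists_reduction, fun L hL =>
      exists_isZariskiOpen_isZariskiDense ?_⟩⟩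
  filter_upwards [h.eventually_specialize, hL.eventually_specialize]
    with P ⟨h1, h2, h3, h4, h5, h6, h7⟩ ⟨h8, h9, h10, h11⟩
  exact ⟨h1, _, _, _, _, _, _, h2, h3, h4, h5, h6, h8, h7, h9, h10, h11⟩
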